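/- Let $A,B\in\mathbb R$, $\lambda>0$, $n\ge 1$, let $a_1,\dots,a_n\in\mathbb C$ (not necessarily distinct) satisfy $\operatorname{Im}a_k>0$, and write $a_k=\alpha_k+i\beta_k$ with $\alpha_k,\beta_k\in\mathbb R$. Let $\rho_0\in\mathbb C\setminus\{0\}$ and put $$\nu_n(z)=\prod_{k=1}^n(z-a_k),\qquad \tau_n(z)=\prod_{k=1}^n(z-\overline{a_k}),\qquad \rho_n(z)=\rho_0\,\nu_n(z).$$ Let $\chi_k=\frac{|1+a_k^2|}{1+a_k^2}$ (with $\chi_k=1$ if $a_k=i$) and let $$\Phi_k(z)=\frac{\sqrt{\operatorname{Im}a_k}}{z-\overline{a_k}}\prod_{j=1}^{k-1}\chi_j\frac{z-a_j}{z-\overline{a_j}},\qquad k=1,\dots,n,$$ be the corresponding Takenaka–Malmquist system. Put $$R_n(z)=\frac{A+Bz}{(z^2+\lambda^2)^2\,\tau_n(z)},\qquad S_n(z;R_n)=\sum_{k=1}^n c_k(R_n)\Phi_k(z),\qquad c_k(R_n)=\frac1\pi\int_{-\infty}^{\infty}R_n(t)\,\overline{\Phi_k(t)}\,dt .$$ Let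 $P_{n-1}$ be the set of polynomials with complex coefficients of degree at most $n-1$, and for $p\in P_{n-1}$ let $$\mathcal F_n(p,\lambda)=\int_{-\infty}^{\infty}\left|\frac{A+Bt}{(t^2+\lambda^2)^2}-p(t)\right|^2\frac{dt}{|\rho_n(t)|^2}.$$ Then this integral converges for every $p\in P_{n-1}$. The function $\tau_n(z)S_n(z;R_n)$ coincides off the zeros of $\tau_n$ with a polynomial $T_{n-1}(z,\lambda)\in P_{n-1}$, and $T_{n-1}(\cdot,\lambda)$ is the unique minimizer of $\mathcal F_n(\cdot,\lambda)$ on $P_{n-1}$. Moreover, $$\inf_{p\in P_{n-1}}\mathcal F_n(p,\lambda)=\frac{1}{16\lambda^4|\rho_0|^2}\cdot\frac{2\pi}{\lambda\mu_n}\left[\left(\frac A\lambda+\lambda B\,\mathcal A_{n,\lambda}\right)^2+\frac{3A^2+\lambda^2B^2}{2\lambda^2}+\frac{3A^2+\lambda^2B^2}{\lambda}\,\mathcal B_{n,\lambda}+A^2\mathcal A_{n,\lambda}^2+(A^2+\lambda^2B^2)\,\mathcal B_{n,\lambda}^2\right],$$ where $$\mu_n=\prod_{k=1}^n\left[\alpha_k^2+(\beta_k+\lambda)^2\right],\qquad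 \mathcal A_{n,\lambda}=\sum_{k=1}^n\frac{\alpha_k}{\alpha_k^2+(\beta_k+\lambda)^2},\qquad \mathcal B_{n,\lambda}=\sum_{k=1}^n\frac{\beta_k+\lambda}{\alpha_k^2+(\beta_k+\lambda)^2}.$$ -/

import Mathlib

open MeasureTheory Polynomial

namespace WeightedApprox

noncomputable section

/-! The nodes `a_1, …, a_n` are the values `a 0, …, a (n - 1)` of a sequence `a : ℕ → ℂ`, so
`a k`, `chi (a k)`, `Phi a k` and `coeff … k` carry the index `k + 1` of the usual notation. -/

/-- The unimodular factor `|1 + a²| / (1 + a²)` of a Blaschke product in the upper half-plane,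
with the usual convention that it is `1` at `a = i`. -/
def chi (a : ℂ) : ℂ := if 1 + a ^ 2 = 0 then 1 else (‖1 + a ^ 2‖ : ℂ) / (1 + a ^ 2)

/-- The finite Blaschke product with zeros `a 0, …, a (k - 1)`. -/
def blaschke (a : ℕ → ℂ) (k : ℕ) (z : ℂ) : ℂ :=
  ∏ j ∈ Finset.range k, chi (a j) * ((z - a j) / (z - (starRingEnd ℂ) (a j)))

/-- The Takenaka–Malmquist system of rational functions. -/
def Phi (a : ℕ → ℂ) (k : ℕ) (z : ℂ) : ℂ :=
  (Real.sqrt (a k).im : ℂ) / (z - (starRingEnd ℂ) (a k)) * blaschke a k z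

/-- `ν_n(z) = ∏ (z - a_k)`. -/
def nu (a : ℕ → ℂ) (n : ℕ) (z : ℂ) : ℂ := ∏ k ∈ Finset.range n, (z - a k)

/-- `τ_n(z) = ∏ (z - conj a_k)`. -/
def tau (a : ℕ → ℂ) (n : ℕ) (z : ℂ) : ℂ := ∏ k ∈ Finset.range n, (z - (starRingEnd ℂ) (a k))

/-- `ρ_n(z) = ρ_0 ν_n(z)`. -/
def rho (ρ₀ : ℂ) (a : ℕ → ℂ) (n : ℕ) (z : ℂ) : ℂ := ρ₀ * nu a n z

/-- The kernel `(A + B z) / (z² + λ²)²`. -/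
def kernel (A B l : ℝ) (z : ℂ) : ℂ := ((A : ℂ) + (B : ℂ) * z) / (z ^ 2 + (l : ℂ) ^ 2) ^ 2

/-- `R_n(z, λ) = (A + B z) / ((z² + λ²)² τ_n(z))`. -/
def R (A B l : ℝ) (a : ℕ → ℂ) (n : ℕ) (z : ℂ) : ℂ :=
  ((A : ℂ) + (B : ℂ) * z) / ((z ^ 2 + (l : ℂ) ^ 2) ^ 2 * tau a n z)

/-- The Fourier coefficient `(1/π) ∫ f(t) conj (Φ_k(t)) dt`. -/
def coeff (a : ℕ → ℂ) (f : ℂ → ℂ) (k : ℕ) : ℂ :=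
  (1 / (Real.pi : ℂ)) * ∫ t : ℝ, f (t : ℂ) * (starRingEnd ℂ) (Phi a k (t : ℂ))

/-- The partial sum of order `n` of the Fourier series of `f` in the system `Phi a`. -/
def S (a : ℕ → ℂ) (n : ℕ) (f : ℂ → ℂ) (z : ℂ) : ℂ :=
  ∑ k ∈ Finset.range n, coeff a f k * Phi a k z

/-- Complex polynomials of degree at most `n - 1` (used for `n ≥ 1`). -/
def P (n : ℕ) : Set ℂ[X] := {p | p.natDegree ≤ n - 1}

/-- `T` is the polynomial `τ_n · S_n(R_n)`: the two sides agree wherever the rational function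
`S_n(R_n)` is given by its formula, that is, off the zeros of `τ_n`. -/
def IsT (A B l : ℝ) (a : ℕ → ℂ) (n : ℕ) (T : ℂ[X]) : Prop :=
  ∀ z : ℂ, tau a n z ≠ 0 → T.eval z = tau a n z * S a n (R A B l a n) z

/-- The integrand of the weighted mean-square error. -/
def errorDensity (A B l : ℝ) (ρ₀ : ℂ) (a : ℕ → ℂ) (n : ℕ) (p : ℂ[X]) (t : ℝ) : ℝ :=
  ‖kernel A B l (t : ℂ) - p.eval (t : ℂ)‖ ^ 2 * (1 / ‖rho ρ₀ a n (t : ℂ)‖ ^ 2)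

/-- The weighted mean-square error of the polynomial `p`. -/
def F (A B l : ℝ) (ρ₀ : ℂ) (a : ℕ → ℂ) (n : ℕ) (p : ℂ[X]) : ℝ :=
  ∫ t : ℝ, errorDensity A B l ρ₀ a n p t

/-- `μ_n = ∏ (α_k² + (β_k + λ)²)`, where `a_k = α_k + i β_k`. -/
def mu (l : ℝ) (a : ℕ → ℂ) (n : ℕ) : ℝ :=
  ∏ k ∈ Finset.range n, ((a k).re ^ 2 + ((a k).im + l) ^ 2)

/-- `𝒜_{n,λ} = ∑ α_k / (α_k² + (β_k + λ)²)`. -/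
def sumA (l : ℝ) (a : ℕ → ℂ) (n : ℕ) : ℝ :=
  ∑ k ∈ Finset.range n, (a k).re / ((a k).re ^ 2 + ((a k).im + l) ^ 2)

/-- `ℬ_{n,λ} = ∑ (β_k + λ) / (α_k² + (β_k + λ)²)`. -/
def sumB (l : ℝ) (a : ℕ → ℂ) (n : ℕ) : ℝ :=
  ∑ k ∈ Finset.range n, ((a k).im + l) / ((a k).re ^ 2 + ((a k).im + l) ^ 2)

end

end WeightedApprox

namespace WeightedApprox

open Filter Topology

/-! On the real line `|ρ_n| = |ρ₀| |τ_n|`, so the problem is to approximate `R_n` in L² by the space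
of quotients `p / τ_n`, `deg p < n`, and everything rests on an explicit orthogonal splitting `R_n =
E + T / τ_n`.

Let `G` have a double pole at `-il` and no other pole, and let `E = conj G + (ν_n / τ_n) G` on the
real line. Since `ν_n` and `τ_n` are conjugate there, both terms of `E * conj (q / τ_n)` reduce, up
to conjugation, to `G` times some `q' / τ_n`. This is holomorphic in the closed upper half-plane and
`O(|z|⁻²)`, so its integral vanishes and `E` is orthogonal to the space
(`integral_errFun_mul_conj_quot`). The two coefficients of `G` are fixed by matching the principal
part of `R_n` at `-il`; realness of `A`, `B`, `l` then settles `il` by conjugation, and the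
remainder is a polynomial `T` of degree below `n` (`exists_poly_decomposition`).

Pythagoras (`F_eq`) makes `T` the unique minimizer. The Takenaka–Malmquist functions form an
orthogonal basis of the space, so `T / τ_n` is the Fourier sum of `R_n` (`isT_of_decomposition`).
Finally `‖E‖² = 2 ‖G‖²`, because the two terms of `E` have equal modulus and their cross term
integrates `(ν_n / τ_n) G²`, again holomorphic above (`integral_norm_sq_errFun`); `‖G‖²` is
elementary. -/

/-! ### Growth and integrability of rational functions with poles in the lower half-plane. -/

theorem exists_mul_one_add_norm_le_norm_sub {w : ℂ} (hw : w.im < 0) :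
    ∃ c : ℝ, 0 < c ∧ ∀ z : ℂ, 0 ≤ z.im → c * (1 + ‖z‖) ≤ ‖z - w‖ := by
  have hd : 0 < -w.im := by linarith
  have hpos : 0 < 1 + (1 + ‖w‖) / (-w.im) := by positivity
  -- From `1 + ‖z‖ ≤ ‖z - w‖ + (1 + ‖w‖)`, where the last term is absorbed using `‖z - w‖ ≥ -w.im`.
  refine ⟨(1 + (1 + ‖w‖) / (-w.im))⁻¹, by positivity, fun z hz => ?_⟩
  rw [inv_mul_le_iff₀ hpos]
  have h1 : -w.im ≤ ‖z - w‖ := by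
    have := Complex.abs_im_le_norm (z - w)
    have h2 := le_abs_self (z - w).im
    simp only [Complex.sub_im] at this h2
    linarith
  have h2 : ‖z‖ ≤ ‖z - w‖ + ‖w‖ := by simpa using norm_add_le (z - w) w
  have h3 : (1 + ‖w‖) ≤ (1 + ‖w‖) / (-w.im) * ‖z - w‖ := by
    rw [div_mul_eq_mul_div, le_div_iff₀ hd]
    gcongr
  linarith

/-- All roots lie strictly below the real axis, so each linear factor is comparable to `1 + ‖z‖` on
the closed upper half-plane. -/
theorem exists_mul_pow_le_norm_eval {q : ℂ[X]} (hq : ∀ z : ℂ, 0 ≤ z.im → q.eval z ≠ 0) :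
    ∃ c : ℝ, 0 < c ∧ ∀ z : ℂ, 0 ≤ z.im → c * (1 + ‖z‖) ^ q.natDegree ≤ ‖q.eval z‖ := by
  have hq0 : q ≠ 0 := by
    rintro rfl
    exact hq 0 le_rfl (by simp)
  have key : ∀ s : Multiset ℂ, (∀ w ∈ s, w.im < 0) → ∃ c : ℝ, 0 < c ∧ ∀ z : ℂ, 0 ≤ z.im →
      c * (1 + ‖z‖) ^ Multiset.card s ≤ ‖(s.map fun w => z - w).prod‖ := by
    intro s
    induction s using Multiset.induction_on with
    | empty => exact fun _ => ⟨1, one_pos, by simp⟩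
    | cons w s ih =>
      intro hs
      obtain ⟨c, hc, h⟩ := ih fun v hv => hs v (Multiset.mem_cons_of_mem hv)
      obtain ⟨d, hd, h'⟩ := exists_mul_one_add_norm_le_norm_sub (hs w (Multiset.mem_cons_self w s))
      refine ⟨d * c, by positivity, fun z hz => ?_⟩
      rw [Multiset.map_cons, Multiset.prod_cons, norm_mul, Multiset.card_cons]
      calc d * c * (1 + ‖z‖) ^ (Multiset.card s + 1)
          = (d * (1 + ‖z‖)) * (c * (1 + ‖z‖) ^ Multiset.card s) := by ring
        _ ≤ _ := by
          gcongr
          exacts [h' z hz, h z hz]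
  obtain ⟨c, hc, h⟩ := key q.roots fun w hw => by
    by_contra! h
    exact hq w h (isRoot_of_mem_roots hw)
  have hsp := IsAlgClosed.splits q
  refine ⟨‖q.leadingCoeff‖ * c, mul_pos (norm_pos_iff.2 (leadingCoeff_ne_zero.2 hq0)) hc,
    fun z hz => ?_⟩
  rw [hsp.eval_eq_prod_roots, norm_mul, hsp.natDegree_eq_card_roots, mul_assoc]
  gcongr
  exact h z hz

theorem exists_norm_eval_le_mul_pow (p : ℂ[X]) :
    ∃ C : ℝ, 0 ≤ C ∧ ∀ z : ℂ, ‖p.eval z‖ ≤ C * (1 + ‖z‖) ^ p.natDegree := by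
  refine ⟨∑ i ∈ Finset.range (p.natDegree + 1), ‖p.coeff i‖, by positivity, fun z => ?_⟩
  rw [eval_eq_sum_range, Finset.sum_mul]
  refine (norm_sum_le _ _).trans (Finset.sum_le_sum fun i hi => ?_)
  rw [norm_mul, norm_pow]
  gcongr
  calc ‖z‖ ^ i ≤ (1 + ‖z‖) ^ i := by gcongr; linarith
    _ ≤ _ := pow_le_pow_right₀ (by linarith [norm_nonneg z]) (by simpa [Nat.lt_succ_iff] using hi)

theorem exists_norm_eval_div_le {p q : ℂ[X]} {m : ℕ} (hq : ∀ z : ℂ, 0 ≤ z.im → q.eval z ≠ 0)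
    (hpq : p.natDegree + m ≤ q.natDegree) :
    ∃ C : ℝ, 0 ≤ C ∧ ∀ z : ℂ, 0 ≤ z.im → ‖p.eval z / q.eval z‖ ≤ C / (1 + ‖z‖) ^ m := by
  obtain ⟨c, hc, h⟩ := exists_mul_pow_le_norm_eval hq
  obtain ⟨C, hC, h'⟩ := exists_norm_eval_le_mul_pow p
  refine ⟨C / c, by positivity, fun z hz => ?_⟩
  have h1 : 1 ≤ 1 + ‖z‖ := by linarith [norm_nonneg z]
  have h0 : 0 < ‖q.eval z‖ := norm_pos_iff.2 (hq z hz)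
  rw [norm_div, div_div, div_le_div_iff₀ h0 (by positivity)]
  calc ‖p.eval z‖ * (c * (1 + ‖z‖) ^ m) ≤ C * (1 + ‖z‖) ^ p.natDegree * (c * (1 + ‖z‖) ^ m) := by
        gcongr; exact h' z
    _ = C * (c * (1 + ‖z‖) ^ (p.natDegree + m)) := by ring
    _ ≤ C * (c * (1 + ‖z‖) ^ q.natDegree) := by gcongr
    _ ≤ _ := by gcongr; exact h z hz

theorem continuous_eval_div_eval {p q : ℂ[X]} (hq : ∀ z : ℂ, 0 ≤ z.im → q.eval z ≠ 0) :
    Continuous fun t : ℝ => p.eval (t : ℂ) / q.eval (t : ℂ) :=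
  (p.continuous.comp Complex.continuous_ofReal).div (q.continuous.comp Complex.continuous_ofReal)
    fun t => hq t (by simp)

theorem integrable_one_div_one_add_abs_sq : Integrable fun t : ℝ => 1 / (1 + |t|) ^ 2 := by
  refine (integrable_inv_one_add_sq).mono' ?_ (ae_of_all _ fun t => ?_)
  · refine Continuous.aestronglyMeasurable (continuous_const.div (by fun_prop) fun t => ?_)
    positivity
  · rw [Real.norm_of_nonneg (by positivity), one_div]
    gcongr
    nlinarith [abs_nonneg t, sq_abs t]

theorem integrable_eval_div_eval {p q : ℂ[X]} (hq : ∀ z : ℂ, 0 ≤ z.im → q.eval z ≠ 0)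
    (hpq : p.natDegree + 2 ≤ q.natDegree) :
    Integrable fun t : ℝ => p.eval (t : ℂ) / q.eval (t : ℂ) := by
  obtain ⟨C, -, h⟩ := exists_norm_eval_div_le hq hpq
  refine (integrable_one_div_one_add_abs_sq.const_mul C).mono'
    (continuous_eval_div_eval hq).aestronglyMeasurable (ae_of_all _ fun t => ?_)
  simpa [div_eq_mul_inv] using h t (by simp)

theorem memLp_eval_div_eval {p q : ℂ[X]} (hq : ∀ z : ℂ, 0 ≤ z.im → q.eval z ≠ 0)
    (hpq : p.natDegree + 1 ≤ q.natDegree) :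
    MemLp (fun t : ℝ => p.eval (t : ℂ) / q.eval (t : ℂ)) 2 := by
  obtain ⟨C, -, h⟩ := exists_norm_eval_div_le hq hpq
  refine (memLp_two_iff_integrable_sq_norm
    (continuous_eval_div_eval hq).aestronglyMeasurable).2 ?_
  refine (integrable_one_div_one_add_abs_sq.const_mul (C ^ 2)).mono'
    ((continuous_eval_div_eval hq).norm.pow 2).aestronglyMeasurable (ae_of_all _ fun t => ?_)
  have := h t (by simp)
  rw [Real.norm_of_nonneg (by positivity), mul_one_div, ← div_pow]
  gcongr
  simpa using this

/-! ### Integrals over the real line: Cauchy's theorem and the double pole. -/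

/-- A rational function without poles in the closed upper half-plane, vanishing to second order at
infinity, has integral zero over the real line. -/
theorem integral_eval_div_eval_eq_zero {p q : ℂ[X]} (hq : ∀ z : ℂ, 0 ≤ z.im → q.eval z ≠ 0)
    (hpq : p.natDegree + 2 ≤ q.natDegree) :
    ∫ t : ℝ, p.eval (t : ℂ) / q.eval (t : ℂ) = 0 := by
  obtain ⟨C, hC, h⟩ := exists_norm_eval_div_le hq hpq
  set f : ℂ → ℂ := fun z => p.eval z / q.eval z with hf
  have hlim : Tendsto (fun r : ℝ => ∫ t in -r..r, f t) atTop (𝓝 (∫ t : ℝ, f t)) :=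
    intervalIntegral_tendsto_integral (integrable_eval_div_eval hq hpq) tendsto_neg_atTop_atBot
      tendsto_id
  refine tendsto_nhds_unique hlim ?_
  have hbound : ∀ r : ℝ, 0 < r → ∀ z : ℂ, 0 ≤ z.im → r ≤ ‖z‖ → ‖f z‖ ≤ C / r ^ 2 := by
    intro r hr z hz hrz
    refine (h z hz).trans ?_
    gcongr
    linarith
  -- Cauchy's theorem on the rectangle `[-r, r] × [0, r]`: the three sides off the real axis have
  -- total length `4r`, and there `f` is at most `C / r²`.
  refine squeeze_zero_norm' (a := fun r : ℝ => 4 * C / r) ?_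
    (tendsto_const_nhds.div_atTop tendsto_id)
  filter_upwards [eventually_gt_atTop 0] with r hr
  have hcauchy := Complex.integral_boundary_rect_eq_zero_of_differentiableOn f (-r : ℝ) (r + r * Complex.I) (by
    intro z hz
    have hz' : 0 ≤ z.im := by
      have := hz.2
      simp [Set.uIcc_of_le hr.le] at this
      exact this.1
    exact (p.differentiable.differentiableAt.div q.differentiable.differentiableAt
      (hq z hz')).differentiableWithinAt)
  simp only [Complex.ofReal_re, Complex.ofReal_im, Complex.add_re, Complex.add_im, Complex.mul_re,
    Complex.mul_im, Complex.I_re, Complex.I_im, mul_zero, mul_one, sub_zero, add_zero, zero_add,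
    Complex.ofReal_zero, zero_mul] at hcauchy
  have htop : ‖∫ x in -r..r, f (x + r * Complex.I)‖ ≤ C / r ^ 2 * |r - -r| := by
    refine intervalIntegral.norm_integral_le_of_norm_le_const fun x _ => hbound r hr _ ?_ ?_
    · simpa using hr.le
    · have := Complex.abs_im_le_norm (x + r * Complex.I)
      simpa [abs_of_pos hr] using this
  have hside : ∀ s : ℝ, |s| = r → ‖∫ y in (0 : ℝ)..r, f (s + y * Complex.I)‖ ≤ C / r ^ 2 * |r - 0| := by
    intro s hs
    refine intervalIntegral.norm_integral_le_of_norm_le_const fun y hy => hbound r hr _ ?_ ?_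
    · rw [Set.uIoc_of_le hr.le] at hy
      simpa using hy.1.le
    · have := Complex.abs_re_le_norm (s + y * Complex.I)
      simpa [hs] using this
  have h1 := hside r (abs_of_pos hr)
  have h2 := hside (-r) (by rw [abs_neg, abs_of_pos hr])
  have heq : ∫ t in -r..r, f t = (∫ x in -r..r, f (x + r * Complex.I))
      - Complex.I • (∫ y in (0 : ℝ)..r, f (r + y * Complex.I))
      + Complex.I • (∫ y in (0 : ℝ)..r, f ((-r : ℝ) + y * Complex.I)) := by
    linear_combination hcauchy
  rw [heq]
  refine (norm_add_le _ _).trans ((add_le_add (norm_sub_le _ _) le_rfl).trans ?_)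
  rw [norm_smul, norm_smul, Complex.norm_I, one_mul, one_mul]
  refine (add_le_add (add_le_add htop h1) h2).trans (le_of_eq ?_)
  rw [sub_neg_eq_add, sub_zero, abs_of_pos hr, abs_of_pos (by positivity)]
  field_simp
  ring

/-- The `s` term integrates to `-s / (2 (t² + l²))`; the `k` term is reduced to an arctangent by
differentiating `t / (t² + l²)`. -/
theorem hasDerivAt_antideriv {l : ℝ} (hl : 0 < l) (c s k t : ℝ) :
    HasDerivAt (fun t : ℝ => (c / l + k / (2 * l ^ 3)) * Real.arctan (t / l)
        + (k * t - l ^ 2 * s) / (2 * l ^ 2 * (t ^ 2 + l ^ 2)))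
      (c / (t ^ 2 + l ^ 2) + (s * t + k) / (t ^ 2 + l ^ 2) ^ 2) t := by
  have h0 : t ^ 2 + l ^ 2 ≠ 0 := by positivity
  have h1 := (((hasDerivAt_id' t).div_const l).arctan).const_mul (c / l + k / (2 * l ^ 3))
  have h2 := ((((hasDerivAt_id' t).const_mul k).sub_const (l ^ 2 * s)).div
    (((hasDerivAt_pow 2 t).add_const (l ^ 2)).const_mul (2 * l ^ 2)) (by positivity))
  refine (h1.add h2).congr_deriv ?_
  have h3 : 1 + (t / l) ^ 2 = (t ^ 2 + l ^ 2) / l ^ 2 := by field_simp; ring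
  simp only [h3]
  field_simp
  ring

theorem integral_div_add_div_sq {l : ℝ} (hl : 0 < l) (c s k : ℝ)
    (hint : Integrable fun t : ℝ => c / (t ^ 2 + l ^ 2) + (s * t + k) / (t ^ 2 + l ^ 2) ^ 2) :
    ∫ t : ℝ, (c / (t ^ 2 + l ^ 2) + (s * t + k) / (t ^ 2 + l ^ 2) ^ 2) =
      Real.pi * (c / l + k / (2 * l ^ 3)) := by
  have hrat : ∀ {F : Filter ℝ}, Tendsto (fun t : ℝ => |t|) F atTop →
      Tendsto (fun t : ℝ => (k * t - l ^ 2 * s) / (2 * l ^ 2 * (t ^ 2 + l ^ 2))) F (𝓝 0) := by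
    intro F hF
    refine squeeze_zero_norm' (a := fun t : ℝ => (|k| + l ^ 2 * |s|) / (2 * l ^ 2) / |t|) ?_
      (tendsto_const_nhds.div_atTop hF)
    filter_upwards [hF.eventually_ge_atTop 1] with t ht
    have h0 : 0 < |t| := by linarith
    rw [Real.norm_eq_abs, abs_div, abs_of_pos (show 0 < 2 * l ^ 2 * (t ^ 2 + l ^ 2) by positivity),
      div_div, div_le_div_iff₀ (by positivity) (by positivity)]
    have h1 : |k * t - l ^ 2 * s| ≤ (|k| + l ^ 2 * |s|) * |t| := by
      refine (abs_sub _ _).trans ?_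
      rw [abs_mul, abs_mul, abs_of_pos (show 0 < l ^ 2 by positivity), add_mul]
      exact add_le_add_right (le_mul_of_one_le_right (by positivity) ht) _
    calc |k * t - l ^ 2 * s| * (2 * l ^ 2 * |t|)
        ≤ (|k| + l ^ 2 * |s|) * |t| * (2 * l ^ 2 * |t|) := by gcongr
      _ = (|k| + l ^ 2 * |s|) * (2 * l ^ 2 * t ^ 2) := by rw [← sq_abs t]; ring
      _ ≤ _ := by
        gcongr
        nlinarith
  have htop := ((Real.tendsto_arctan_atTop.mono_right nhdsWithin_le_nhds).comp
    (tendsto_id.atTop_div_const hl)).const_mul (c / l + k / (2 * l ^ 3))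
  have hbot := ((Real.tendsto_arctan_atBot.mono_right nhdsWithin_le_nhds).comp
    (tendsto_id.atBot_div_const hl)).const_mul (c / l + k / (2 * l ^ 3))
  rw [integral_of_hasDerivAt_of_tendsto (hasDerivAt_antideriv hl c s k) hint
    (hbot.add (hrat tendsto_abs_atBot_atTop)) (htop.add (hrat tendsto_abs_atTop_atTop))]
  ring

theorem integral_div_sq_add_sq {b : ℝ} (hb : 0 < b) :
    ∫ t : ℝ, b / (t ^ 2 + b ^ 2) = Real.pi := by
  have hint : Integrable fun t : ℝ => b / (t ^ 2 + b ^ 2) := by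
    have h := (integrable_inv_one_add_sq.comp_div hb.ne').const_mul (b⁻¹)
    refine h.congr (ae_of_all _ fun t => ?_)
    simp only
    field_simp
    ring
  have h := integral_div_add_div_sq hb b 0 0 (by simpa using hint)
  simpa [hb.ne'] using h

/-- The squared norm on the real line of a rational function with a double pole at `-i l`. -/
theorem integral_norm_sq_double_pole {l : ℝ} (hl : 0 < l) (m₀ m₁ : ℂ)
    (hint : Integrable fun t : ℝ =>
      ‖(m₁ + m₀ * (t + l * Complex.I)) / (t + l * Complex.I) ^ 2‖ ^ 2) :
    ∫ t : ℝ, ‖(m₁ + m₀ * (t + l * Complex.I)) / (t + l * Complex.I) ^ 2‖ ^ 2 =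
      Real.pi / l * (Complex.normSq m₀ + Complex.normSq m₁ / (2 * l ^ 2)
        + (m₁ * (starRingEnd ℂ) m₀).im / l) := by
  -- The cross term of the numerator is twice the real part of `m₁ * conj m₀ * (t - il)`, which
  -- contributes the linear term in `t` and the imaginary part.
  have key : ∀ t : ℝ, ‖(m₁ + m₀ * (t + l * Complex.I)) / (t + l * Complex.I) ^ 2‖ ^ 2 =
      Complex.normSq m₀ / (t ^ 2 + l ^ 2)
        + (2 * (m₁ * (starRingEnd ℂ) m₀).re * t
          + (Complex.normSq m₁ + 2 * l * (m₁ * (starRingEnd ℂ) m₀).im)) / (t ^ 2 + l ^ 2) ^ 2 := by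
    intro t
    have h0 : t ^ 2 + l ^ 2 ≠ 0 := by positivity
    have h1 : ‖(t : ℂ) + l * Complex.I‖ ^ 2 = t ^ 2 + l ^ 2 := by
      rw [← Complex.normSq_eq_norm_sq, Complex.normSq_add_mul_I]
    rw [norm_div, norm_pow, div_pow, ← pow_mul, mul_comm 2 2, pow_mul, h1,
      ← Complex.normSq_eq_norm_sq]
    field_simp
    simp [Complex.normSq_apply]
    ring
  simp_rw [key] at hint ⊢
  rw [integral_div_add_div_sq hl _ _ _ hint]
  field_simp
  ring

/-! ### The Takenaka–Malmquist system: basis property and orthogonality. -/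

noncomputable section

/-- The polynomial `ν_n`. -/
def nuPoly (a : ℕ → ℂ) (n : ℕ) : ℂ[X] := ∏ k ∈ Finset.range n, (X - C (a k))

/-- The polynomial `τ_n`. -/
def tauPoly (a : ℕ → ℂ) (n : ℕ) : ℂ[X] := (nuPoly a n).map (starRingEnd ℂ)

/-- The polynomial `τ_n Φ_{k+1}`. -/
def phiPoly (a : ℕ → ℂ) (n k : ℕ) : ℂ[X] :=
  C (Real.sqrt (a k).im : ℂ) * (∏ j ∈ Finset.range k, C (chi (a j)) * (X - C (a j))) *
    ∏ j ∈ Finset.Ico (k + 1) n, (X - C ((starRingEnd ℂ) (a j)))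

end

theorem eval_map_conj (p : ℂ[X]) (z : ℂ) :
    (p.map (starRingEnd ℂ)).eval z = (starRingEnd ℂ) (p.eval ((starRingEnd ℂ) z)) := by
  rw [← Polynomial.eval_map_apply, Complex.conj_conj]

theorem eval_map_conj_ofReal (p : ℂ[X]) (t : ℝ) :
    (p.map (starRingEnd ℂ)).eval (t : ℂ) = (starRingEnd ℂ) (p.eval (t : ℂ)) := by
  rw [eval_map_conj, Complex.conj_ofReal]

theorem eval_nuPoly (a : ℕ → ℂ) (n : ℕ) (z : ℂ) : (nuPoly a n).eval z = nu a n z := by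
  simp [nuPoly, nu, eval_prod]

theorem tauPoly_eq_prod (a : ℕ → ℂ) (n : ℕ) :
    tauPoly a n = ∏ k ∈ Finset.range n, (X - C ((starRingEnd ℂ) (a k))) := by
  simp [tauPoly, nuPoly, Polynomial.map_prod]

theorem eval_tauPoly (a : ℕ → ℂ) (n : ℕ) (z : ℂ) : (tauPoly a n).eval z = tau a n z := by
  simp [tauPoly_eq_prod, tau, eval_prod]

theorem tau_ofReal (a : ℕ → ℂ) (n : ℕ) (t : ℝ) :
    tau a n (t : ℂ) = (starRingEnd ℂ) (nu a n (t : ℂ)) := by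
  rw [← eval_tauPoly, tauPoly, eval_map_conj_ofReal, eval_nuPoly]

theorem natDegree_nuPoly (a : ℕ → ℂ) (n : ℕ) : (nuPoly a n).natDegree = n := by
  simp [nuPoly]

theorem natDegree_tauPoly (a : ℕ → ℂ) (n : ℕ) : (tauPoly a n).natDegree = n := by
  rw [tauPoly, natDegree_map, natDegree_nuPoly]

theorem sub_conj_ne_zero {w z : ℂ} (hw : 0 < w.im) (hz : 0 ≤ z.im) :
    z - (starRingEnd ℂ) w ≠ 0 := by
  intro h
  have := congrArg Complex.im h
  simp at this
  linarith

theorem tau_ne_zero {a : ℕ → ℂ} {n : ℕ} (ha : ∀ k < n, 0 < (a k).im) {z : ℂ} (hz : 0 ≤ z.im) :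
    tau a n z ≠ 0 :=
  Finset.prod_ne_zero_iff.2 fun k hk => sub_conj_ne_zero (ha k (Finset.mem_range.1 hk)) hz

theorem norm_chi (w : ℂ) : ‖chi w‖ = 1 := by
  unfold chi
  split_ifs with h
  · simp
  · rw [norm_div, Complex.norm_real, norm_norm, div_self (norm_ne_zero_iff.2 h)]

theorem chi_ne_zero (w : ℂ) : chi w ≠ 0 := norm_ne_zero_iff.1 (by simp [norm_chi])

theorem eval_phiPoly {a : ℕ → ℂ} {n k : ℕ} (hk : k < n) {z : ℂ} (hz : tau a n z ≠ 0) :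
    (phiPoly a n k).eval z = tau a n z * Phi a k z := by
  have hsplit : tau a n z = (∏ j ∈ Finset.range k, (z - (starRingEnd ℂ) (a j))) *
      ((z - (starRingEnd ℂ) (a k)) *
        ∏ j ∈ Finset.Ico (k + 1) n, (z - (starRingEnd ℂ) (a j))) := by
    rw [← Finset.prod_eq_prod_Ico_succ_bot hk (fun j => z - (starRingEnd ℂ) (a j)), tau,
      Finset.prod_range_mul_prod_Ico _ hk.le]
  rw [hsplit] at hz
  have h1 := left_ne_zero_of_mul hz
  have h2 := left_ne_zero_of_mul (right_ne_zero_of_mul hz)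
  rw [hsplit, Phi, blaschke, phiPoly]
  simp only [eval_mul, eval_C, eval_prod, eval_sub, eval_X, Finset.prod_mul_distrib,
    Finset.prod_div_distrib]
  field_simp

theorem natDegree_phiPoly_lt {a : ℕ → ℂ} {n k : ℕ} (hk : k < n) :
    (phiPoly a n k).natDegree < n := by
  have h1 : (∏ j ∈ Finset.range k, C (chi (a j)) * (X - C (a j))).natDegree ≤ k := by
    refine (natDegree_prod_le _ _).trans ?_
    refine (Finset.sum_le_card_nsmul _ _ 1 fun j _ => ?_).trans (by simp)
    exact (natDegree_C_mul_le _ _).trans (natDegree_X_sub_C_le _)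
  have h2 : (∏ j ∈ Finset.Ico (k + 1) n, (X - C ((starRingEnd ℂ) (a j)))).natDegree
      = n - (k + 1) := by
    simp
  have h3 := (natDegree_mul_le (p := C (Real.sqrt (a k).im : ℂ) *
    (∏ j ∈ Finset.range k, C (chi (a j)) * (X - C (a j))))
    (q := ∏ j ∈ Finset.Ico (k + 1) n, (X - C ((starRingEnd ℂ) (a j)))))
  have h4 := natDegree_C_mul_le (Real.sqrt (a k).im : ℂ)
    (∏ j ∈ Finset.range k, C (chi (a j)) * (X - C (a j)))
  unfold phiPoly
  omega

/-- Newton-type interpolation: at the conjugate of the last node every basis polynomial but the last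
vanishes, so evaluation there gives the last coefficient. Dividing the rest by the corresponding
linear factor leaves the same problem with one node fewer. -/
theorem exists_eq_sum_phiPoly (a : ℕ → ℂ) : ∀ n : ℕ, (∀ k < n, 0 < (a k).im) → ∀ q : ℂ[X],
    q.degree < n → ∃ d : ℕ → ℂ, q = ∑ k ∈ Finset.range n, C (d k) * phiPoly a n k := by
  intro n
  induction n with
  | zero =>
    intro _ q hq
    exact ⟨0, by simpa using hq⟩
  | succ n ih =>
    intro ha q hq
    set w := (starRingEnd ℂ) (a n) with hw
    have hne : (phiPoly a (n + 1) n).eval w ≠ 0 := by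
      have hs : (Real.sqrt (a n).im : ℂ) ≠ 0 := by
        simpa using (Real.sqrt_pos.2 (ha n n.lt_succ_self)).ne'
      simp only [phiPoly, Finset.Ico_self, Finset.prod_empty, mul_one, eval_mul, eval_C, eval_prod,
        eval_sub, eval_X]
      refine mul_ne_zero hs (Finset.prod_ne_zero_iff.2 fun j hj =>
        mul_ne_zero (chi_ne_zero _) fun h => ?_)
      have h1 := congrArg Complex.im h
      have h2 := ha n n.lt_succ_self
      have h3 := ha j ((Finset.mem_range.1 hj).trans n.lt_succ_self)
      simp [hw] at h1
      linarith
    set c := q.eval w / (phiPoly a (n + 1) n).eval w with hc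
    obtain ⟨r, hr⟩ : X - C w ∣ q - C c * phiPoly a (n + 1) n := by
      rw [dvd_iff_isRoot, IsRoot, eval_sub, eval_mul, eval_C, hc, div_mul_cancel₀ _ hne, sub_self]
    have hdeg : (q - C c * phiPoly a (n + 1) n).degree < ((n + 1 : ℕ) : WithBot ℕ) := by
      refine (degree_sub_le _ _).trans_lt (max_lt hq ?_)
      refine (degree_le_natDegree.trans_lt ?_)
      exact_mod_cast (natDegree_C_mul_le _ _).trans_lt (natDegree_phiPoly_lt n.lt_succ_self)
    have hrdeg : r.degree < n := by
      rcases eq_or_ne r 0 with rfl | hr0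
      · simp
      rw [hr, degree_mul, degree_X_sub_C, degree_eq_natDegree hr0] at hdeg
      rw [degree_eq_natDegree hr0]
      norm_cast at hdeg ⊢
      omega
    obtain ⟨d, hd⟩ := ih (fun k hk => ha k (hk.trans n.lt_succ_self)) r hrdeg
    refine ⟨fun k => if k = n then c else d k, ?_⟩
    simp only [Finset.sum_range_succ, ↓reduceIte]
    refine (eq_add_of_sub_eq hr).trans (congrArg (· + _) ?_)
    conv_lhs => rw [hd]
    rw [Finset.mul_sum]
    refine Finset.sum_congr rfl fun k hk => ?_
    rw [Finset.mem_range] at hk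
    rw [if_neg hk.ne, phiPoly, phiPoly, Finset.prod_Ico_succ_top (by omega)]
    ring

theorem blaschke_mul_conj {a : ℕ → ℂ} {k : ℕ} (ha : ∀ j < k, 0 < (a j).im) (t : ℝ) :
    blaschke a k t * (starRingEnd ℂ) (blaschke a k t) = 1 := by
  rw [Complex.mul_conj, Complex.normSq_eq_norm_sq, blaschke, norm_prod, Finset.prod_eq_one]
  · simp
  · intro j hj
    have h := sub_conj_ne_zero (ha j (Finset.mem_range.1 hj)) (z := (t : ℂ)) (by simp)
    have h' : ‖(t : ℂ) - a j‖ = ‖(t : ℂ) - (starRingEnd ℂ) (a j)‖ := by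
      rw [← Complex.norm_conj]
      simp
    rw [norm_mul, norm_chi, norm_div, h', div_self (norm_ne_zero_iff.2 h), one_mul]

theorem integral_phi_mul_conj_self {a : ℕ → ℂ} {k : ℕ} (ha : ∀ j < k + 1, 0 < (a j).im) :
    ∫ t : ℝ, Phi a k t * (starRingEnd ℂ) (Phi a k t) = Real.pi := by
  have hk := ha k k.lt_succ_self
  have key : ∀ t : ℝ, Phi a k t * (starRingEnd ℂ) (Phi a k t) =
      (((a k).im / ((t - (a k).re) ^ 2 + (a k).im ^ 2) : ℝ) : ℂ) := by
    intro t
    have h1 := blaschke_mul_conj (k := k) (fun j hj => ha j (hj.trans k.lt_succ_self)) t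
    have h2 : ((t : ℂ) - (starRingEnd ℂ) (a k)) * (starRingEnd ℂ) ((t : ℂ) - (starRingEnd ℂ) (a k))
        = (((t - (a k).re) ^ 2 + (a k).im ^ 2 : ℝ) : ℂ) := by
      rw [Complex.mul_conj, Complex.normSq_apply]
      simp
      ring
    have h3 : (Real.sqrt (a k).im : ℂ) * Real.sqrt (a k).im = (a k).im := by
      rw [← Complex.ofReal_mul, Real.mul_self_sqrt hk.le]
    rw [Phi, map_mul, mul_mul_mul_comm, h1, mul_one, map_div₀, div_mul_div_comm, h2,
      Complex.conj_ofReal, h3, Complex.ofReal_div]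
  simp_rw [key]
  rw [integral_complex_ofReal, integral_sub_right_eq_self
    (fun t : ℝ => (a k).im / (t ^ 2 + (a k).im ^ 2)), integral_div_sq_add_sq hk]

/-- The common Blaschke factor is unimodular on the line and drops out. The one upper pole, at `a
j`, comes from conjugating `Phi a j` and is cancelled by a zero of `Phi a k`. What remains is `p /
q` with poles below the axis and a degree gap of 2. -/
theorem integral_phi_mul_conj_of_lt {a : ℕ → ℂ} {j k : ℕ} (hjk : j < k)
    (ha : ∀ i < k + 1, 0 < (a i).im) :
    ∫ t : ℝ, Phi a k t * (starRingEnd ℂ) (Phi a j t) = 0 := by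
  set q : ℂ[X] := ∏ i ∈ Finset.Ico j (k + 1), (X - C ((starRingEnd ℂ) (a i))) with hq
  set p : ℂ[X] := C ((Real.sqrt (a k).im : ℂ) * Real.sqrt (a j).im * ∏ i ∈ Finset.Ico j k, chi (a i))
    * ∏ i ∈ Finset.Ico (j + 1) k, (X - C (a i)) with hp
  have hp' : p.natDegree ≤ k - (j + 1) := (natDegree_C_mul_le _ _).trans (by simp)
  have hq' : q.natDegree = k + 1 - j := by simp [hq]
  have hq0 : ∀ z : ℂ, 0 ≤ z.im → q.eval z ≠ 0 := by
    intro z hz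
    rw [hq, eval_prod]
    refine Finset.prod_ne_zero_iff.2 fun i hi => ?_
    simpa using sub_conj_ne_zero (ha i (Finset.mem_Ico.1 hi).2) hz
  rw [← integral_eval_div_eval_eq_zero hq0 (p := p) (by omega)]
  congr 1
  ext t
  have h1 := blaschke_mul_conj (k := j) (fun i hi => ha i (by omega)) t
  have h2 : blaschke a k t = blaschke a j t * ((∏ i ∈ Finset.Ico j k, chi (a i)) *
      (((t : ℂ) - a j) * (∏ i ∈ Finset.Ico (j + 1) k, ((t : ℂ) - a i)) /
        ∏ i ∈ Finset.Ico j k, ((t : ℂ) - (starRingEnd ℂ) (a i)))) := by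
    rw [← Finset.prod_eq_prod_Ico_succ_bot hjk (fun i => (t : ℂ) - a i), ← Finset.prod_div_distrib,
      ← Finset.prod_mul_distrib, blaschke, blaschke, Finset.prod_range_mul_prod_Ico _ hjk.le]
  have h3 : (t : ℂ) - a j ≠ 0 := by
    intro h
    have h' := congrArg Complex.im h
    simp at h'
    exact (ha j (by omega)).ne' h'
  have h4 : ∀ i < k + 1, (t : ℂ) - (starRingEnd ℂ) (a i) ≠ 0 := fun i hi =>
    sub_conj_ne_zero (ha i hi) (by simp)
  have h5 : ∏ i ∈ Finset.Ico j k, ((t : ℂ) - (starRingEnd ℂ) (a i)) ≠ 0 :=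
    Finset.prod_ne_zero_iff.2 fun i hi => h4 i (by have := (Finset.mem_Ico.1 hi).2; omega)
  have h6 := h4 k k.lt_succ_self
  have h7 : p.eval (t : ℂ) = (Real.sqrt (a k).im : ℂ) * Real.sqrt (a j).im *
      (∏ i ∈ Finset.Ico j k, chi (a i)) * ∏ i ∈ Finset.Ico (j + 1) k, ((t : ℂ) - a i) := by
    simp [hp, eval_prod]
  have h8 : q.eval (t : ℂ) = (∏ i ∈ Finset.Ico j k, ((t : ℂ) - (starRingEnd ℂ) (a i))) *
      ((t : ℂ) - (starRingEnd ℂ) (a k)) := by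
    rw [hq, Finset.prod_Ico_succ_top (by omega)]
    simp [eval_prod]
  rw [h7, h8, Phi, Phi, h2, map_mul, map_div₀, map_sub, Complex.conj_conj, Complex.conj_ofReal,
    Complex.conj_ofReal]
  calc _ = (blaschke a j t * (starRingEnd ℂ) (blaschke a j t)) * ((Real.sqrt (a k).im : ℂ) *
        Real.sqrt (a j).im * (∏ i ∈ Finset.Ico j k, chi (a i)) *
        ∏ i ∈ Finset.Ico (j + 1) k, ((t : ℂ) - a i)) /
        ((∏ i ∈ Finset.Ico j k, ((t : ℂ) - (starRingEnd ℂ) (a i))) *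
      ((t : ℂ) - (starRingEnd ℂ) (a k))) := by
        field_simp
    _ = _ := by rw [h1, one_mul]

theorem integral_phi_mul_conj {a : ℕ → ℂ} {n j k : ℕ} (ha : ∀ i < n, 0 < (a i).im) (hj : j < n)
    (hk : k < n) :
    ∫ t : ℝ, Phi a j t * (starRingEnd ℂ) (Phi a k t) = if j = k then (Real.pi : ℂ) else 0 := by
  rcases lt_trichotomy j k with h | rfl | h
  · rw [if_neg h.ne, ← Complex.conj_conj (integral _ _), ← integral_conj]
    simp_rw [map_mul, Complex.conj_conj, mul_comm ((starRingEnd ℂ) _)]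
    rw [integral_phi_mul_conj_of_lt h fun i hi => ha i (by omega), map_zero]
  · rw [if_pos rfl, integral_phi_mul_conj_self fun i hi => ha i (by omega)]
  · rw [if_neg h.ne', integral_phi_mul_conj_of_lt h fun i hi => ha i (by omega)]

/-! ### Removing the double poles at `±il`. -/

theorem sq_X_sub_C_dvd {p : ℂ[X]} {w : ℂ} (h : p.eval w = 0) (h' : p.derivative.eval w = 0) :
    (X - C w) ^ 2 ∣ p := by
  obtain ⟨r, rfl⟩ := dvd_iff_isRoot.2 h
  have hr : r.IsRoot w := by simpa using h'
  rw [sq]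
  exact mul_dvd_mul_left _ (dvd_iff_isRoot.2 hr)

theorem eval_derivative_nuPoly (a : ℕ → ℂ) (n : ℕ) {w : ℂ} (hw : ∀ k < n, w - a k ≠ 0) :
    (nuPoly a n).derivative.eval w = nu a n w * ∑ k ∈ Finset.range n, 1 / (w - a k) := by
  induction n with
  | zero => simp [nuPoly]
  | succ n ih =>
    have h := hw n n.lt_succ_self
    have ih' := ih fun k hk => hw k (hk.trans n.lt_succ_self)
    rw [nuPoly, Finset.prod_range_succ, ← nuPoly, derivative_mul, eval_add, eval_mul, eval_mul, ih',
      eval_nuPoly, Finset.sum_range_succ]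
    have hnu : nu a (n + 1) w = nu a n w * (w - a n) := Finset.prod_range_succ _ _
    rw [hnu]
    simp only [eval_sub, eval_X, eval_C, derivative_sub, derivative_X, derivative_C, sub_zero,
      eval_one]
    field_simp

/-- This is minus the logarithmic derivative of `ν_n` at `-il`, the source of both sums in the final
formula. -/
theorem sum_one_div_add_mul_I (l : ℝ) (a : ℕ → ℂ) (n : ℕ) :
    ∑ k ∈ Finset.range n, 1 / (a k + l * Complex.I) =
      (sumA l a n : ℂ) - (sumB l a n : ℂ) * Complex.I := by
  simp only [sumA, sumB, Complex.ofReal_sum]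
  rw [Finset.sum_mul, ← Finset.sum_sub_distrib]
  refine Finset.sum_congr rfl fun k _ => ?_
  apply Complex.ext <;> simp [Complex.normSq_apply, -Complex.ofReal_div] <;>
    ring

/-- The numerator of the rational function with a double pole at `-i l`, with principal part
coefficients `m₁` and `m₀`. -/
noncomputable def poleNum (l : ℝ) (m₀ m₁ : ℂ) : ℂ[X] := C m₁ + C m₀ * (X + C (l * Complex.I))

theorem natDegree_poleNum_le (l : ℝ) (m₀ m₁ : ℂ) : (poleNum l m₀ m₁).natDegree ≤ 1 := by
  unfold poleNum
  compute_degree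

/-- Hypotheses `h₁` and `h₀` match value and derivative at `-il`, with `-4 l²` the value of `(z -
il)²` there. The remaining numerator then has double zeros at `-il` and, being fixed by conjugation,
at `il`. Dividing a polynomial of degree at most `n + 3` by a quartic leaves degree below `n`. -/
theorem exists_poly_decomposition (A B : ℝ) {l : ℝ} (hl : 0 < l) {n : ℕ} {a : ℕ → ℂ}
    (ha : ∀ k < n, 0 < (a k).im) {m₀ m₁ : ℂ}
    (h₁ : -4 * (l : ℂ) ^ 2 * nu a n (-(l * Complex.I)) * m₁ = A - B * (l * Complex.I))
    (h₀ : -4 * (l : ℂ) ^ 2 * nu a n (-(l * Complex.I)) * m₀ =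
      ((sumA l a n : ℂ) - (sumB l a n : ℂ) * Complex.I) * (A - B * (l * Complex.I))
        - A / l * Complex.I) :
    ∃ T : ℂ[X], T.degree < n ∧ C (A : ℂ) + C (B : ℂ) * X =
      (X ^ 2 + C ((l : ℂ) ^ 2)) ^ 2 * T
        + nuPoly a n * poleNum l m₀ m₁ * (X - C (l * Complex.I)) ^ 2
        + (nuPoly a n * poleNum l m₀ m₁ * (X - C (l * Complex.I)) ^ 2).map (starRingEnd ℂ) := by
  set κ : ℂ := l * Complex.I with hκ
  have hl0 : (l : ℂ) ≠ 0 := by exact_mod_cast hl.ne'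
  have hκ2 : κ ^ 2 = -(l : ℂ) ^ 2 := by rw [hκ, mul_pow, Complex.I_sq]; ring
  have hκc : (starRingEnd ℂ) κ = -κ := by simp [hκ]
  have hκ0 : κ ≠ 0 := mul_ne_zero hl0 Complex.I_ne_zero
  set Q : ℂ[X] := nuPoly a n * poleNum l m₀ m₁ * (X - C κ) ^ 2 with hQ
  set N : ℂ[X] := C (A : ℂ) + C (B : ℂ) * X - Q - Q.map (starRingEnd ℂ) with hN
  have hmap : (X - C κ).map (starRingEnd ℂ) = X - C (-κ) := by simp [hκc]
  have hsum : ∑ k ∈ Finset.range n, 1 / (-κ - a k) =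
      -((sumA l a n : ℂ) - (sumB l a n : ℂ) * Complex.I) := by
    rw [← sum_one_div_add_mul_I, ← Finset.sum_neg_distrib]
    refine Finset.sum_congr rfl fun k _ => ?_
    rw [← neg_add', div_neg, add_comm]
  have hnu : ∀ k < n, -κ - a k ≠ 0 := by
    intro k hk h
    have h' := congrArg Complex.im h
    have := ha k hk
    simp [hκ] at h'
    linarith
  have hd1 : (X - C (-κ)) ^ 2 ∣ C (A : ℂ) + C (B : ℂ) * X - Q := by
    refine sq_X_sub_C_dvd ?_ ?_
    · simp only [hQ, poleNum, ← hκ, eval_add, eval_sub, eval_mul, eval_pow, eval_C, eval_X,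
        eval_nuPoly]
      linear_combination (-4 * nu a n (-κ) * m₁) * hκ2 - h₁
    · have h2 : A / l * Complex.I = A / (l : ℂ) ^ 2 * κ := by rw [hκ]; field_simp
      simp only [hQ, poleNum, ← hκ, derivative_add, derivative_sub, derivative_mul, derivative_C,
        derivative_X, derivative_pow, eval_add, eval_sub, eval_mul, eval_pow, eval_C, eval_X,
        eval_nuPoly, eval_derivative_nuPoly a n hnu, hsum, eval_zero, eval_one]
      generalize (sumA l a n : ℂ) - (sumB l a n : ℂ) * Complex.I = s at *
      generalize nu a n (-κ) = v at *
      rw [h2] at h₀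
      have h3 : 4 * v * m₁ = -(A - B * κ) / (l : ℂ) ^ 2 := by
        rw [← h₁]; field_simp
      have h4 : (κ / (l : ℂ) ^ 2) * κ = -1 := by
        field_simp
        exact hκ2
      push_cast
      linear_combination (-4 * v * (-s * m₁ + m₀)) * hκ2 + s * h₁ - h₀ + κ * h3 + B * h4
  -- Conjugation turns the factor `(X - κ)²` of `Q` into `(X + κ)²`, so this term does not disturb
  -- the matching at `-κ`.
  have hd2 : (X - C (-κ)) ^ 2 ∣ Q.map (starRingEnd ℂ) := by
    rw [hQ, Polynomial.map_mul, Polynomial.map_pow, hmap]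
    exact dvd_mul_left _ _
  have hd3 : (X - C (-κ)) ^ 2 ∣ N := dvd_sub hd1 hd2
  have hNmap : N.map (starRingEnd ℂ) = N := by
    have : (Q.map (starRingEnd ℂ)).map (starRingEnd ℂ) = Q := by
      rw [Polynomial.map_map]
      convert Polynomial.map_id
      ext z
      simp
    rw [hN]
    simp only [Polynomial.map_sub, Polynomial.map_add, Polynomial.map_mul, map_C, map_X, this,
      Complex.conj_ofReal]
    ring
  have hd4 : (X - C κ) ^ 2 ∣ N := by
    have := Polynomial.map_dvd (starRingEnd ℂ) hd3
    rwa [hNmap, Polynomial.map_pow, Polynomial.map_sub, map_X, map_C, map_neg, hκc, neg_neg] at this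
  have hcop : IsCoprime ((X - C (-κ)) ^ 2) ((X - C κ) ^ 2) := by
    refine IsCoprime.pow (isCoprime_X_sub_C_of_isUnit_sub (IsUnit.mk0 _ ?_))
    intro h
    exact hκ0 (by linear_combination -h / 2)
  obtain ⟨T, hT⟩ := hcop.mul_dvd hd3 hd4
  have hprod : (X - C (-κ)) ^ 2 * (X - C κ) ^ 2 = (X ^ 2 + C ((l : ℂ) ^ 2)) ^ 2 := by
    have : C ((l : ℂ) ^ 2) = - C κ ^ 2 := by rw [← C_pow, hκ2, C_neg, neg_neg]
    rw [this, C_neg]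
    ring
  refine ⟨T, ?_, ?_⟩
  · have hQdeg : Q.natDegree ≤ n + 3 := by
      have h1 := natDegree_mul_le (p := nuPoly a n * poleNum l m₀ m₁) (q := (X - C κ) ^ 2)
      have h2 := natDegree_mul_le (p := nuPoly a n) (q := poleNum l m₀ m₁)
      have h3 := natDegree_poleNum_le l m₀ m₁
      rw [natDegree_nuPoly] at h2
      rw [natDegree_pow, natDegree_X_sub_C] at h1
      rw [hQ]
      omega
    have hlin : (C (A : ℂ) + C (B : ℂ) * X).natDegree ≤ 1 := by compute_degree
    have hQdeg' : (Q.map (starRingEnd ℂ)).natDegree ≤ n + 3 :=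
      (natDegree_map _).trans_le hQdeg
    have hNdeg : N.natDegree ≤ n + 3 := by
      have h1 := natDegree_sub_le (C (A : ℂ) + C (B : ℂ) * X - Q) (Q.map (starRingEnd ℂ))
      have h2 := natDegree_sub_le (C (A : ℂ) + C (B : ℂ) * X) Q
      rw [← hN] at h1
      omega
    rcases eq_or_ne T 0 with rfl | hT0
    · simp
    have hmon : ((X - C (-κ)) ^ 2 * (X - C κ) ^ 2).Monic :=
      ((monic_X_sub_C _).pow 2).mul ((monic_X_sub_C _).pow 2)
    have hdeg4 : ((X - C (-κ)) ^ 2 * (X - C κ) ^ 2).natDegree = 4 := by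
      rw [((monic_X_sub_C _).pow 2).natDegree_mul ((monic_X_sub_C _).pow 2), natDegree_pow,
        natDegree_pow, natDegree_X_sub_C, natDegree_X_sub_C]
    rw [hT, hmon.natDegree_mul' hT0, hdeg4] at hNdeg
    rw [degree_eq_natDegree hT0]
    norm_cast
    omega
  · rw [← hprod, ← hT, hN]
    ring

/-! ### The error function: orthogonality and norm. -/

noncomputable section

/-- The polynomial `(z + i l)²`. -/
def poleDen (l : ℝ) : ℂ[X] := (X + C (l * Complex.I)) ^ 2

/-- The rational function with a double pole at `-i l` on the real line. -/
def poleFun (l : ℝ) (m₀ m₁ : ℂ) (t : ℝ) : ℂ :=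
  (poleNum l m₀ m₁).eval (t : ℂ) / (poleDen l).eval (t : ℂ)

/-- The weighted error of the best approximation on the real line. -/
def errFun (l : ℝ) (a : ℕ → ℂ) (n : ℕ) (m₀ m₁ : ℂ) (t : ℝ) : ℂ :=
  (starRingEnd ℂ) (poleFun l m₀ m₁ t) + nu a n t / tau a n t * poleFun l m₀ m₁ t

/-- The rational function `q / τ_n` on the real line. -/
def quot (a : ℕ → ℂ) (n : ℕ) (q : ℂ[X]) (t : ℝ) : ℂ := q.eval (t : ℂ) / (tauPoly a n).eval (t : ℂ)

end

theorem monic_poleDen (l : ℝ) : (poleDen l).Monic := (monic_X_add_C _).pow 2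

theorem monic_tauPoly (a : ℕ → ℂ) (n : ℕ) : (tauPoly a n).Monic := by
  rw [tauPoly_eq_prod]
  exact monic_prod_of_monic _ _ fun k _ => monic_X_sub_C _

theorem natDegree_poleDen (l : ℝ) : (poleDen l).natDegree = 2 := by
  rw [poleDen, natDegree_pow, natDegree_X_add_C]

theorem poleDen_eval_ne_zero {l : ℝ} (hl : 0 < l) (z : ℂ) (hz : 0 ≤ z.im) :
    (poleDen l).eval z ≠ 0 := by
  intro h
  have h' := congrArg Complex.im (pow_eq_zero_iff two_ne_zero |>.1 ((eval_pow 2).symm.trans h))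
  simp at h'
  linarith

section

variable {l : ℝ} {n : ℕ} {a : ℕ → ℂ}

theorem tauPoly_eval_ne_zero (ha : ∀ k < n, 0 < (a k).im) (z : ℂ) (hz : 0 ≤ z.im) :
    (tauPoly a n).eval z ≠ 0 := by
  rw [eval_tauPoly]
  exact tau_ne_zero ha hz

theorem tauPoly_mul_poleDen_eval_ne_zero (hl : 0 < l) (ha : ∀ k < n, 0 < (a k).im) (z : ℂ)
    (hz : 0 ≤ z.im) : (tauPoly a n * poleDen l).eval z ≠ 0 := by
  rw [eval_mul]
  exact mul_ne_zero (tauPoly_eval_ne_zero ha z hz) (poleDen_eval_ne_zero hl z hz)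

theorem natDegree_tauPoly_mul_poleDen : (tauPoly a n * poleDen l).natDegree = n + 2 := by
  rw [(monic_tauPoly a n).natDegree_mul (monic_poleDen l), natDegree_poleDen, natDegree_tauPoly]

theorem memLp_quot (ha : ∀ k < n, 0 < (a k).im) {q : ℂ[X]} (hq : q.natDegree < n) :
    MemLp (quot a n q) 2 :=
  memLp_eval_div_eval (tauPoly_eval_ne_zero ha) (by rw [natDegree_tauPoly]; exact hq)

theorem memLp_poleFun (hl : 0 < l) (m₀ m₁ : ℂ) : MemLp (poleFun l m₀ m₁) 2 :=
  memLp_eval_div_eval (poleDen_eval_ne_zero hl) (by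
    rw [natDegree_poleDen]
    have := natDegree_poleNum_le l m₀ m₁
    omega)

theorem blaschke_mul_poleFun (m₀ m₁ : ℂ) (t : ℝ) :
    nu a n t / tau a n t * poleFun l m₀ m₁ t =
      (nuPoly a n * poleNum l m₀ m₁).eval (t : ℂ) / (tauPoly a n * poleDen l).eval (t : ℂ) := by
  rw [eval_mul, eval_mul, eval_nuPoly, eval_tauPoly, poleFun, div_mul_div_comm]

theorem natDegree_nuPoly_mul_poleNum_le (m₀ m₁ : ℂ) :
    (nuPoly a n * poleNum l m₀ m₁).natDegree ≤ n + 1 := by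
  have h1 := natDegree_poleNum_le l m₀ m₁
  have h2 := natDegree_mul_le (p := nuPoly a n) (q := poleNum l m₀ m₁)
  rw [natDegree_nuPoly] at h2
  omega

theorem memLp_blaschke_mul_poleFun (hl : 0 < l) (ha : ∀ k < n, 0 < (a k).im) (m₀ m₁ : ℂ) :
    MemLp (fun t : ℝ => nu a n t / tau a n t * poleFun l m₀ m₁ t) 2 := by
  simp_rw [blaschke_mul_poleFun]
  refine memLp_eval_div_eval (tauPoly_mul_poleDen_eval_ne_zero hl ha) ?_
  rw [natDegree_tauPoly_mul_poleDen]
  have := natDegree_nuPoly_mul_poleNum_le (l := l) (a := a) (n := n) m₀ m₁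
  omega

theorem memLp_errFun (hl : 0 < l) (ha : ∀ k < n, 0 < (a k).im) (m₀ m₁ : ℂ) :
    MemLp (errFun l a n m₀ m₁) 2 :=
  (memLp_poleFun hl m₀ m₁).star.add (memLp_blaschke_mul_poleFun hl ha m₀ m₁)

theorem _root_.MeasureTheory.MemLp.integrable_mul_conj {f g : ℝ → ℂ} (hf : MemLp f 2)
    (hg : MemLp g 2) : Integrable fun t => f t * (starRingEnd ℂ) (g t) :=
  hf.integrable_mul hg.star

theorem _root_.MeasureTheory.MemLp.integrable_norm_sq' {f : ℝ → ℂ} (hf : MemLp f 2) :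
    Integrable fun t => ‖f t‖ ^ 2 :=
  (memLp_two_iff_integrable_sq_norm hf.1).1 hf

/-- The polarization identity for the square norm of a sum, integrated. -/
theorem integral_norm_add_sq {f g : ℝ → ℂ} (hf : MemLp f 2) (hg : MemLp g 2) :
    ∫ t, ‖f t + g t‖ ^ 2 = (∫ t, ‖f t‖ ^ 2) + (∫ t, ‖g t‖ ^ 2)
      + 2 * (∫ t, f t * (starRingEnd ℂ) (g t)).re := by
  have h1 := hf.integrable_norm_sq'
  have h2 := hg.integrable_norm_sq'
  have h3 := hf.integrable_mul_conj hg
  have hre : (∫ t, f t * (starRingEnd ℂ) (g t)).re = ∫ t, (f t * (starRingEnd ℂ) (g t)).re :=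
    (integral_re h3).symm
  have h3' : Integrable fun t => (f t * (starRingEnd ℂ) (g t)).re := h3.re
  have hpt : ∀ t, ‖f t + g t‖ ^ 2 =
      ‖f t‖ ^ 2 + ‖g t‖ ^ 2 + 2 * (f t * (starRingEnd ℂ) (g t)).re := by
    intro t
    simp_rw [← Complex.normSq_eq_norm_sq]
    exact Complex.normSq_add _ _
  have h12 : Integrable fun t => ‖f t‖ ^ 2 + ‖g t‖ ^ 2 := h1.add h2
  simp_rw [hpt]
  rw [integral_add h12 (h3'.const_mul 2), integral_add h1 h2, integral_const_mul, hre]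

theorem integral_errFun_mul_conj_quot (hl : 0 < l) (ha : ∀ k < n, 0 < (a k).im) (m₀ m₁ : ℂ)
    {q : ℂ[X]} (hq : q.natDegree < n) :
    ∫ t, errFun l a n m₀ m₁ t * (starRingEnd ℂ) (quot a n q t) = 0 := by
  have hvanish : ∀ p : ℂ[X], p.natDegree < n → ∫ t, poleFun l m₀ m₁ t * quot a n p t = 0 := by
    intro p hp
    have h : ∀ t, poleFun l m₀ m₁ t * quot a n p t =
        (poleNum l m₀ m₁ * p).eval (t : ℂ) / (tauPoly a n * poleDen l).eval (t : ℂ) := by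
      intro t
      rw [poleFun, quot, eval_mul, eval_mul, div_mul_div_comm, mul_comm ((poleDen l).eval _)]
    simp_rw [h]
    refine integral_eval_div_eval_eq_zero (tauPoly_mul_poleDen_eval_ne_zero hl ha) ?_
    rw [natDegree_tauPoly_mul_poleDen]
    have h1 := natDegree_poleNum_le l m₀ m₁
    have h2 := natDegree_mul_le (p := poleNum l m₀ m₁) (q := p)
    omega
  -- In the second term `conj τ_n = ν_n` cancels the numerator of `ν_n / τ_n`, leaving the
  -- conjugated polynomial over `τ_n`.
  have hsplit : ∀ t, errFun l a n m₀ m₁ t * (starRingEnd ℂ) (quot a n q t) =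
      (starRingEnd ℂ) (poleFun l m₀ m₁ t * quot a n q t)
        + poleFun l m₀ m₁ t * quot a n (q.map (starRingEnd ℂ)) t := by
    intro t
    have h0 := tau_ne_zero ha (z := (t : ℂ)) (by simp)
    have h1 : nu a n (t : ℂ) ≠ 0 := by
      intro h
      rw [tau_ofReal, h, map_zero] at h0
      exact h0 rfl
    rw [errFun, quot, quot, eval_map_conj_ofReal, eval_tauPoly, map_mul, map_div₀]
    nth_rw 2 [tau_ofReal]
    nth_rw 2 [tau_ofReal]
    rw [Complex.conj_conj]
    field_simp
  simp_rw [hsplit]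
  have hq' : (q.map (starRingEnd ℂ)).natDegree < n := (natDegree_map _).trans_lt hq
  have hi : ∀ p : ℂ[X], p.natDegree < n →
      Integrable fun t => poleFun l m₀ m₁ t * quot a n p t := fun p hp =>
    (memLp_poleFun hl m₀ m₁).integrable_mul (memLp_quot ha hp)
  have hi' : Integrable fun t => (starRingEnd ℂ) (poleFun l m₀ m₁ t * quot a n q t) :=
    Complex.conjCLE.toContinuousLinearMap.integrable_comp (hi q hq)
  rw [integral_add hi' (hi _ hq'), integral_conj, hvanish q hq, hvanish _ hq', map_zero, add_zero]

theorem norm_tau_ofReal (a : ℕ → ℂ) (n : ℕ) (t : ℝ) : ‖tau a n (t : ℂ)‖ = ‖nu a n (t : ℂ)‖ := by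
  rw [tau_ofReal, Complex.norm_conj]

theorem integral_norm_sq_errFun (hl : 0 < l) (ha : ∀ k < n, 0 < (a k).im) (m₀ m₁ : ℂ) :
    ∫ t, ‖errFun l a n m₀ m₁ t‖ ^ 2 = 2 * (Real.pi / l * (Complex.normSq m₀
      + Complex.normSq m₁ / (2 * l ^ 2) + (m₁ * (starRingEnd ℂ) m₀).im / l)) := by
  have hG := memLp_poleFun hl m₀ m₁
  have hpt : ∀ t : ℝ, poleFun l m₀ m₁ t =
      (m₁ + m₀ * (t + l * Complex.I)) / (t + l * Complex.I) ^ 2 := by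
    intro t
    simp [poleFun, poleNum, poleDen]
  have hint := hG.integrable_norm_sq'
  have hval : ∫ t, ‖poleFun l m₀ m₁ t‖ ^ 2 = Real.pi / l * (Complex.normSq m₀
      + Complex.normSq m₁ / (2 * l ^ 2) + (m₁ * (starRingEnd ℂ) m₀).im / l) := by
    simp_rw [hpt] at hint ⊢
    exact integral_norm_sq_double_pole hl m₀ m₁ hint
  have hb : ∀ t : ℝ, ‖nu a n t / tau a n t * poleFun l m₀ m₁ t‖ = ‖poleFun l m₀ m₁ t‖ := by
    intro t
    have h0 := tau_ne_zero ha (z := (t : ℂ)) (by simp)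
    rw [norm_mul, norm_div, ← norm_tau_ofReal, div_self (norm_ne_zero_iff.2 h0), one_mul]
  have hcross : ∫ t : ℝ, nu a n t / tau a n t * poleFun l m₀ m₁ t *
      (starRingEnd ℂ) ((starRingEnd ℂ) (poleFun l m₀ m₁ t)) = 0 := by
    have h : ∀ t : ℝ, nu a n t / tau a n t * poleFun l m₀ m₁ t *
        (starRingEnd ℂ) ((starRingEnd ℂ) (poleFun l m₀ m₁ t)) =
        (nuPoly a n * poleNum l m₀ m₁ * poleNum l m₀ m₁).eval (t : ℂ) /
          (tauPoly a n * poleDen l * poleDen l).eval (t : ℂ) := by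
      intro t
      rw [Complex.conj_conj, blaschke_mul_poleFun, poleFun, div_mul_div_comm, ← eval_mul,
        ← eval_mul]
    simp_rw [h]
    refine integral_eval_div_eval_eq_zero (fun z hz => ?_) ?_
    · rw [eval_mul]
      exact mul_ne_zero (tauPoly_mul_poleDen_eval_ne_zero hl ha z hz)
        (poleDen_eval_ne_zero hl z hz)
    · have h1 := natDegree_poleNum_le l m₀ m₁
      have h2 := natDegree_nuPoly_mul_poleNum_le (l := l) (a := a) (n := n) m₀ m₁
      have h3 := natDegree_mul_le (p := nuPoly a n * poleNum l m₀ m₁) (q := poleNum l m₀ m₁)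
      have h4 : (tauPoly a n * poleDen l * poleDen l).natDegree = n + 4 := by
        rw [((monic_tauPoly a n).mul (monic_poleDen l)).natDegree_mul (monic_poleDen l),
          natDegree_tauPoly_mul_poleDen, natDegree_poleDen]
      omega
  have hstar : MemLp (fun t => (starRingEnd ℂ) (poleFun l m₀ m₁ t)) 2 := hG.star
  have hsum := integral_norm_add_sq (memLp_blaschke_mul_poleFun hl ha m₀ m₁) hstar
  rw [hcross] at hsum
  simp_rw [hb, Complex.norm_conj, hval] at hsum
  simp_rw [errFun, add_comm ((starRingEnd ℂ) _)]
  rw [hsum]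
  simp only [Complex.zero_re]
  ring

end

/-! ### Pythagoras, uniqueness and the Fourier sum. -/

section

variable {A B l : ℝ} {n : ℕ} {a : ℕ → ℂ} {m₀ m₁ ρ₀ : ℂ} {T : ℂ[X]}

theorem kernel_sub_eval_div_tau (hl : 0 < l) (ha : ∀ k < n, 0 < (a k).im)
    (hT : C (A : ℂ) + C (B : ℂ) * X = (X ^ 2 + C ((l : ℂ) ^ 2)) ^ 2 * T
      + nuPoly a n * poleNum l m₀ m₁ * (X - C (l * Complex.I)) ^ 2
      + (nuPoly a n * poleNum l m₀ m₁ * (X - C (l * Complex.I)) ^ 2).map (starRingEnd ℂ))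
    (p : ℂ[X]) (t : ℝ) :
    (kernel A B l t - p.eval (t : ℂ)) / tau a n t =
      errFun l a n m₀ m₁ t + quot a n (T - p) t := by
  have h := congrArg (eval (t : ℂ)) hT
  rw [eval_add, eval_add, eval_map_conj_ofReal] at h
  simp only [eval_add, eval_mul, eval_pow, eval_sub, eval_C, eval_X, eval_nuPoly, map_mul, map_pow,
    map_sub, Complex.conj_ofReal, Complex.conj_I, ← tau_ofReal] at h
  have h0 := tau_ne_zero ha (z := (t : ℂ)) (by simp)
  have h1 : (t : ℂ) + l * Complex.I ≠ 0 := by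
    intro h
    simpa [hl.ne'] using congrArg Complex.im h
  have h2 : (t : ℂ) - l * Complex.I ≠ 0 := by
    intro h
    simpa [hl.ne'] using congrArg Complex.im h
  have h3 : (t : ℂ) ^ 2 + (l : ℂ) ^ 2 = (t + l * Complex.I) * (t - l * Complex.I) := by
    linear_combination ((l : ℂ) ^ 2) * Complex.I_sq
  rw [kernel, h, h3, errFun, quot, poleFun, poleDen, eval_tauPoly]
  simp only [eval_add, eval_pow, eval_sub, eval_C, eval_X]
  simp only [map_div₀, map_pow, map_add, map_mul, Complex.conj_ofReal, Complex.conj_I, mul_neg,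
    ← sub_eq_add_neg, sub_neg_eq_add]
  field_simp
  ring

theorem errorDensity_eq (hl : 0 < l) (ha : ∀ k < n, 0 < (a k).im)
    (hT : C (A : ℂ) + C (B : ℂ) * X = (X ^ 2 + C ((l : ℂ) ^ 2)) ^ 2 * T
      + nuPoly a n * poleNum l m₀ m₁ * (X - C (l * Complex.I)) ^ 2
      + (nuPoly a n * poleNum l m₀ m₁ * (X - C (l * Complex.I)) ^ 2).map (starRingEnd ℂ))
    (p : ℂ[X]) (t : ℝ) :
    errorDensity A B l ρ₀ a n p t =
      1 / ‖ρ₀‖ ^ 2 * ‖errFun l a n m₀ m₁ t + quot a n (T - p) t‖ ^ 2 := by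
  rw [← kernel_sub_eval_div_tau hl ha hT p t, errorDensity, rho, norm_mul, norm_div,
    norm_tau_ofReal, mul_pow, div_pow, one_div_mul_eq_div, div_div, mul_one_div,
    mul_comm (‖ρ₀‖ ^ 2)]

theorem F_eq (hl : 0 < l) (ha : ∀ k < n, 0 < (a k).im)
    (hT : C (A : ℂ) + C (B : ℂ) * X = (X ^ 2 + C ((l : ℂ) ^ 2)) ^ 2 * T
      + nuPoly a n * poleNum l m₀ m₁ * (X - C (l * Complex.I)) ^ 2
      + (nuPoly a n * poleNum l m₀ m₁ * (X - C (l * Complex.I)) ^ 2).map (starRingEnd ℂ))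
    {p : ℂ[X]} (hp : (T - p).natDegree < n) :
    F A B l ρ₀ a n p = 1 / ‖ρ₀‖ ^ 2 * ((∫ t, ‖errFun l a n m₀ m₁ t‖ ^ 2) +
      ∫ t, ‖quot a n (T - p) t‖ ^ 2) := by
  simp_rw [F, errorDensity_eq hl ha hT]
  rw [integral_const_mul, integral_norm_add_sq (memLp_errFun hl ha m₀ m₁) (memLp_quot ha hp),
    integral_errFun_mul_conj_quot hl ha m₀ m₁ hp]
  simp

/-- By continuity the quotient vanishes at every real point, which gives `q` infinitely many roots.
-/
theorem eq_zero_of_integral_norm_sq_quot_eq_zero (ha : ∀ k < n, 0 < (a k).im) {q : ℂ[X]}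
    (hq : q.natDegree < n) (h : ∫ t, ‖quot a n q t‖ ^ 2 = 0) : q = 0 := by
  have hcont : Continuous fun t => ‖quot a n q t‖ ^ 2 :=
    (continuous_eval_div_eval (tauPoly_eval_ne_zero ha)).norm.pow 2
  have h0 := (integral_eq_zero_iff_of_nonneg (fun t => sq_nonneg _)
    (memLp_quot ha hq).integrable_norm_sq').1 h
  have h1 := (hcont.ae_eq_iff_eq volume continuous_zero).1 h0
  refine eq_zero_of_infinite_isRoot q (Set.Infinite.mono ?_
    (Set.infinite_range_of_injective Complex.ofReal_injective))
  rintro _ ⟨t, rfl⟩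
  have h2 := congrFun h1 t
  simp only [Pi.zero_apply, sq_eq_zero_iff, norm_eq_zero, quot] at h2
  exact (div_eq_zero_iff.1 h2).resolve_right (tauPoly_eval_ne_zero ha _ (by simp))

theorem quot_phiPoly (ha : ∀ k < n, 0 < (a k).im) {k : ℕ} (hk : k < n) (t : ℝ) :
    quot a n (phiPoly a n k) t = Phi a k t := by
  have h0 := tau_ne_zero ha (z := (t : ℂ)) (by simp)
  rw [quot, eval_phiPoly hk h0, eval_tauPoly, mul_div_cancel_left₀ _ h0]

/-- Expanding `T` in the basis and pairing `R_n = E + T / τ_n` with `Phi a k` kills `E`, so the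
Fourier coefficients of `R_n` are those of `T / τ_n`. -/
theorem isT_of_decomposition (hl : 0 < l) (ha : ∀ k < n, 0 < (a k).im) (hdeg : T.degree < n)
    (hn : 1 ≤ n)
    (hT : C (A : ℂ) + C (B : ℂ) * X = (X ^ 2 + C ((l : ℂ) ^ 2)) ^ 2 * T
      + nuPoly a n * poleNum l m₀ m₁ * (X - C (l * Complex.I)) ^ 2
      + (nuPoly a n * poleNum l m₀ m₁ * (X - C (l * Complex.I)) ^ 2).map (starRingEnd ℂ)) :
    IsT A B l a n T := by
  obtain ⟨d, hd⟩ := exists_eq_sum_phiPoly a n ha T hdeg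
  have hTn : T.natDegree < n := by
    rcases eq_or_ne T 0 with h | h
    -- The zero polynomial has `natDegree` 0, so the strict bound needs `1 ≤ n`.
    · rw [h, natDegree_zero]
      omega
    · exact (natDegree_lt_iff_degree_lt h).2 hdeg
  have hPhi : ∀ k < n, MemLp (fun t : ℝ => Phi a k t) 2 := fun k hk => by
    simp_rw [← quot_phiPoly ha hk]
    exact memLp_quot ha (natDegree_phiPoly_lt hk)
  have hquot : ∀ t, quot a n T t = ∑ k ∈ Finset.range n, d k * Phi a k t := by
    intro t
    rw [quot, hd, eval_finsetSum, Finset.sum_div]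
    refine Finset.sum_congr rfl fun k hk => ?_
    rw [eval_mul, eval_C, mul_div_assoc, ← quot, quot_phiPoly ha (Finset.mem_range.1 hk)]
  have hR : ∀ t : ℝ, R A B l a n t = errFun l a n m₀ m₁ t + quot a n T t := by
    intro t
    have h := kernel_sub_eval_div_tau hl ha hT 0 t
    rw [eval_zero, sub_zero, sub_zero] at h
    rw [← h, R, kernel, div_div]
  have hcoeff : ∀ k < n, coeff a (R A B l a n) k = d k := by
    intro k hk
    have h1 := (memLp_errFun hl ha m₀ m₁).integrable_mul_conj (hPhi k hk)
    have h2 := (memLp_quot ha hTn).integrable_mul_conj (hPhi k hk)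
    have h3 : ∫ t, errFun l a n m₀ m₁ t * (starRingEnd ℂ) (Phi a k t) = 0 := by
      simp_rw [← quot_phiPoly ha hk]
      exact integral_errFun_mul_conj_quot hl ha m₀ m₁ (natDegree_phiPoly_lt hk)
    have h4 : ∫ t, quot a n T t * (starRingEnd ℂ) (Phi a k t) = d k * Real.pi := by
      simp_rw [hquot, Finset.sum_mul, mul_assoc]
      rw [integral_finsetSum _ fun j hj =>
        ((hPhi j (Finset.mem_range.1 hj)).integrable_mul_conj (hPhi k hk)).const_mul (d j)]
      rw [Finset.sum_eq_single_of_mem k (Finset.mem_range.2 hk), integral_const_mul,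
        integral_phi_mul_conj ha hk hk, if_pos rfl]
      intro j hj hjk
      rw [integral_const_mul, integral_phi_mul_conj ha (Finset.mem_range.1 hj) hk, if_neg hjk,
        mul_zero]
    simp_rw [coeff, hR, add_mul]
    rw [integral_add h1 h2, h3, h4]
    have : (Real.pi : ℂ) ≠ 0 := by exact_mod_cast Real.pi_ne_zero
    field_simp
    ring
  intro z hz
  rw [S, Finset.mul_sum, hd, eval_finsetSum]
  refine Finset.sum_congr rfl fun k hk => ?_
  have hk' := Finset.mem_range.1 hk
  rw [eval_mul, eval_C, eval_phiPoly hk' hz, hcoeff k hk']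
  ring

theorem normSq_nu_neg_mul_I (l : ℝ) (a : ℕ → ℂ) (n : ℕ) :
    Complex.normSq (nu a n (-(l * Complex.I))) = mu l a n := by
  rw [nu, mu, map_prod]
  refine Finset.prod_congr rfl fun k _ => ?_
  rw [Complex.normSq_apply]
  simp
  ring

theorem mu_pos (hl : 0 < l) (ha : ∀ k < n, 0 < (a k).im) : 0 < mu l a n :=
  Finset.prod_pos fun k hk => by
    have := ha k (Finset.mem_range.1 hk)
    positivity

end

end WeightedApprox

/-! ### Assembly and the closed form of the minimum. -/

open WeightedApprox in
theorem mainTheorem1 (A B l : ℝ) (hl : 0 < l) (n : ℕ) (hn : 1 ≤ n) (a : ℕ → ℂ)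
    (ha : ∀ k < n, 0 < (a k).im) (ρ₀ : ℂ) (hρ : ρ₀ ≠ 0) :
    -- the functional is a convergent integral on the whole class
    (∀ p ∈ WeightedApprox.P n, Integrable (WeightedApprox.errorDensity A B l ρ₀ a n p)) ∧
    -- the polynomial `τ_n · S_n(R_n)` exists and is the unique minimizer
    (∃ T ∈ WeightedApprox.P n, WeightedApprox.IsT A B l a n T ∧
      (∀ p ∈ WeightedApprox.P n,
        WeightedApprox.F A B l ρ₀ a n T ≤ WeightedApprox.F A B l ρ₀ a n p) ∧
      (∀ p ∈ WeightedApprox.P n,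
        WeightedApprox.F A B l ρ₀ a n p = WeightedApprox.F A B l ρ₀ a n T → p = T)) ∧
    -- the minimal value
    sInf (WeightedApprox.F A B l ρ₀ a n '' WeightedApprox.P n) =
      1 / (16 * l ^ 4 * ‖ρ₀‖ ^ 2) * (2 * Real.pi / (l * WeightedApprox.mu l a n)) *
        ((A / l + l * B * WeightedApprox.sumA l a n) ^ 2
          + (3 * A ^ 2 + l ^ 2 * B ^ 2) / (2 * l ^ 2)
          + (3 * A ^ 2 + l ^ 2 * B ^ 2) / l * WeightedApprox.sumB l a n
          + A ^ 2 * WeightedApprox.sumA l a n ^ 2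
          + (A ^ 2 + l ^ 2 * B ^ 2) * WeightedApprox.sumB l a n ^ 2) := by
  have hmu := mu_pos hl ha
  -- Both matching equations have `D` as the coefficient of the unknown, so `m₁ = u / D` and `m₀ = v
  -- / D`; `|D|²` supplies the factor `16 l⁴ μ_n`.
  set D : ℂ := -4 * (l : ℂ) ^ 2 * nu a n (-(l * Complex.I)) with hD
  have hDsq : Complex.normSq D = 16 * l ^ 4 * mu l a n := by
    rw [hD, map_mul, normSq_nu_neg_mul_I, map_mul, map_pow, Complex.normSq_neg,
      Complex.normSq_ofReal, Complex.normSq_ofNat]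
    ring
  have hD0 : D ≠ 0 := by
    rw [← Complex.normSq_pos, hDsq]
    positivity
  set u : ℂ := A - B * (l * Complex.I) with hu
  set v : ℂ := ((sumA l a n : ℂ) - (sumB l a n : ℂ) * Complex.I) * u - A / l * Complex.I with hv
  obtain ⟨T, hdeg, hT⟩ := exists_poly_decomposition A B hl ha (m₁ := u / D) (m₀ := v / D)
    (mul_div_cancel₀ _ hD0) (mul_div_cancel₀ _ hD0)
  have hTn : T.natDegree ≤ n - 1 := by
    rcases eq_or_ne T 0 with h | h
    · simp [h]
    · have := (natDegree_lt_iff_degree_lt h).2 hdeg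
      omega
  have hsub : ∀ p ∈ P n, (T - p).natDegree < n := by
    intro p hp
    have h1 : p.natDegree ≤ n - 1 := hp
    have h2 := natDegree_sub_le T p
    omega
  have hF := fun p hp => F_eq (ρ₀ := ρ₀) hl ha hT (hsub p hp)
  have hFT : F A B l ρ₀ a n T = 1 / ‖ρ₀‖ ^ 2 * ∫ t, ‖errFun l a n (v / D) (u / D) t‖ ^ 2 := by
    rw [hF T hTn, sub_self]
    simp [quot]
  have hρ' : 0 < 1 / ‖ρ₀‖ ^ 2 := by positivity
  have hmin : ∀ p ∈ P n, F A B l ρ₀ a n T ≤ F A B l ρ₀ a n p := by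
    intro p hp
    rw [hF p hp, hFT]
    gcongr
    exact le_add_of_nonneg_right (integral_nonneg fun t => sq_nonneg _)
  refine ⟨fun p hp => ?_, ⟨T, hTn, isT_of_decomposition hl ha hdeg hn hT, hmin, fun p hp h => ?_⟩,
    ?_⟩
  · refine (((memLp_errFun hl ha (v / D) (u / D)).add
      (memLp_quot ha (hsub p hp))).integrable_norm_sq'.const_mul (1 / ‖ρ₀‖ ^ 2)).congr
      (ae_of_all _ fun t => ?_)
    exact (errorDensity_eq hl ha hT p t).symm
  · rw [hF p hp, hFT] at h
    have h1 := mul_left_cancel₀ hρ'.ne' h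
    exact (sub_eq_zero.1 (eq_zero_of_integral_norm_sq_quot_eq_zero ha (hsub p hp)
      (by linarith))).symm
  · have hleast : IsLeast (F A B l ρ₀ a n '' P n) (F A B l ρ₀ a n T) := by
      refine ⟨⟨T, hTn, rfl⟩, ?_⟩
      rintro _ ⟨p, hp, rfl⟩
      exact hmin p hp
    have him : (u / D * (starRingEnd ℂ) (v / D)).im =
        (u * (starRingEnd ℂ) v).im / Complex.normSq D := by
      rw [map_div₀, div_mul_div_comm, Complex.mul_conj D, Complex.div_ofReal_im]
    have hure : u.re = A := by simp [hu]
    have huim : u.im = -(B * l) := by simp [hu]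
    have hvre : v.re = sumA l a n * A - sumB l a n * (B * l) := by
      simp [hv, hure, huim]
    have hvim : v.im = -(sumA l a n * (B * l)) - sumB l a n * A - A / l := by
      simp [hv, hure, huim, sub_eq_add_neg]
    rw [hleast.csInf_eq, hFT, integral_norm_sq_errFun hl ha, him, map_div₀, map_div₀, hDsq,
      Complex.mul_im, Complex.conj_re, Complex.conj_im, Complex.normSq_apply, Complex.normSq_apply,
      hure, huim, hvre, hvim]
    have hρ0 : ‖ρ₀‖ ≠ 0 := norm_ne_zero_iff.2 hρ
    field_simp
    ring
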